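/- Let $K\subseteq\mathbb{R}^n$ be non-empty, closed and convex, and let $f:K\to\mathbb{R}^n$ be $C^1$ with $(f(z)-f(w))^T(z-w)\le 0$ for all $z,w\in K$. For $z\in K$ let $N_K(z)=\{v: v^T(w-z)\le 0 \text{ for all } w\in K\}$ be the normal cone, and let $\mathbf{P}_C$ denote the Euclidean projection onto a non-empty closed convex set $C$. Let $\phi:[0,\infty)\times K\to K$ be a semi-flow (continuous, $\phi(0,z)=z$, $\phi(t+s,z)=\phi(t,\phi(s,z))$) whose trajectories $z(t)=\phi(t,z(0))$ are Carathéodory solutions of $$\dot z=f(z)-\mathbf{P}_{N_K(z)}(f(z)),$$ i.e. $z$ is absolutely continuous on compact time intervals and satisfies the equation for almost every $t\ge 0$. Assume that $\phi$ has an equilibrium point, i.e. a point $\bar z\in K$ with $\phi(t,\bar z)=\bar z$ for all $t\ge0$. Let $\Omega=\bigcup_{x\in K}\bigcap_{t\ge 0}\overline{\{\phi(s,x):s\ge t\}}$ be the $\omega$-limit set. A face of $K$ is a convex subset $F\subseteq K$ that contains every line segment of $K$ whose relative interior meets $F$. Let $F$ be the minimal face of $K$ containing all equilibrium points (the intersection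 of all faces containing them), let $V$ be the affine span of $F$, and let $N_V$ be the normal cone of $V$ (the same at each point of $V$). Then: 1. $\Omega\subseteq F$. 2. The vector field $z\mapsto f(z)-\mathbf{P}_{N_V}(f(z))$ is $C^1$ on $K$. 3. The restriction of $\phi$ to $\Omega$ extends to a flow of isometries: there is a flow $\psi:\mathbb{R}\times\Omega\to\Omega$ with $\psi(t,z)=\phi(t,z)$ for all $t\ge 0$, $z\in\Omega$, and $|\psi(t,z)-\psi(t,w)|=|z-w|$ for all $t\in\mathbb{R}$, $z,w\in\Omega$. Moreover each of its trajectories $z(t)=\psi(t,z(0))$ is differentiable and satisfies, for every $t\in\mathbb{R}$, $$\dot z=f(z)-\mathbf{P}_{N_V}(f(z)).$$ -/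

import Mathlib

open Set Filter Topology MeasureTheory
open scoped NNReal RealInnerProductSpace

noncomputable section

section ConvexGeometry

variable {E : Type*} [NormedAddCommGroup E] [InnerProductSpace ℝ E]

/-- The normal cone `N_K(z)` to `K` through `z`. -/
def normalCone (K : Set E) (z : E) : Set E :=
  {v | ∀ w ∈ K, ⟪v, w - z⟫ ≤ 0}

/-- The normal cone `N_V` of an affine subspace, i.e. the common value of `normalCone V z` for
`z ∈ V`; see `normalCone_coe_eq_affineNormalCone`. -/
def affineNormalCone (V : AffineSubspace ℝ E) : Set E :=
  {v | ∀ z ∈ V, v ∈ normalCone (V : Set E) z}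

theorem normalCone_coe_eq_affineNormalCone (V : AffineSubspace ℝ E) {z : E} (hz : z ∈ V) :
    normalCone (V : Set E) z = affineNormalCone V := by
  ext v
  refine ⟨fun h y hy w hw => ?_, fun h => h z hz⟩
  have h1 : (w - y) + z ∈ V :=
    AffineSubspace.vadd_mem_of_mem_direction (AffineSubspace.vsub_mem_direction hw hy) hz
  simpa using h _ h1

/-- The projection `P_C(x)` of `x` onto `C`: a point of `C` nearest to `x`. For `C` non-empty,
closed and convex in a complete space it exists and is unique (`projOnto_spec`, `projOnto_unique`);
where there is no nearest point the value is `0`. -/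
def projOnto (C : Set E) (x : E) : E :=
  open Classical in
  if h : ∃ p ∈ C, ∀ q ∈ C, ‖x - p‖ ≤ ‖x - q‖ then h.choose else 0

theorem projOnto_spec [CompleteSpace E] {C : Set E} (hne : C.Nonempty) (hcl : IsClosed C)
    (hco : Convex ℝ C) (x : E) :
    projOnto C x ∈ C ∧ ∀ q ∈ C, ‖x - projOnto C x‖ ≤ ‖x - q‖ := by
  have h : ∃ p ∈ C, ∀ q ∈ C, ‖x - p‖ ≤ ‖x - q‖ := by
    obtain ⟨p, hp, hpe⟩ := exists_norm_eq_iInf_of_complete_convex hne hcl.isComplete hco x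
    refine ⟨p, hp, fun q hq => ?_⟩
    rw [hpe]
    exact ciInf_le ⟨0, by rintro _ ⟨y, rfl⟩; exact norm_nonneg _⟩ (⟨q, hq⟩ : C)
  rw [projOnto, dif_pos h]
  exact h.choose_spec

theorem projOnto_unique [CompleteSpace E] {C : Set E} (hcl : IsClosed C) (hco : Convex ℝ C)
    {x p : E} (hp : p ∈ C) (hmin : ∀ q ∈ C, ‖x - p‖ ≤ ‖x - q‖) : projOnto C x = p := by
  have key : ∀ r ∈ C, (∀ q ∈ C, ‖x - r‖ ≤ ‖x - q‖) → ∀ w ∈ C, ⟪x - r, w - r⟫ ≤ 0 := by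
    intro r hr hr'
    refine (norm_eq_iInf_iff_real_inner_le_zero hco hr).1 (le_antisymm ?_ ?_)
    · have : Nonempty C := ⟨⟨r, hr⟩⟩
      exact le_ciInf fun w => hr' w w.2
    · exact ciInf_le ⟨0, by rintro _ ⟨y, rfl⟩; exact norm_nonneg _⟩ (⟨r, hr⟩ : C)
  obtain ⟨h1, h2⟩ := projOnto_spec ⟨p, hp⟩ hcl hco x
  have e1 := key _ h1 h2 p hp
  have e2 := key _ hp hmin _ h1
  have e3 : ⟪p - projOnto C x, p - projOnto C x⟫ ≤ 0 := by
    have : ⟪p - projOnto C x, p - projOnto C x⟫ =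
        ⟪x - projOnto C x, p - projOnto C x⟫ + ⟪x - p, projOnto C x - p⟫ := by
      rw [← neg_sub p (projOnto C x), inner_neg_right, ← sub_eq_add_neg, ← inner_sub_left]
      congr 1
      abel
    linarith
  exact (sub_eq_zero.1 ((inner_self_eq_zero (𝕜 := ℝ)).1 (le_antisymm e3 real_inner_self_nonneg))).symm

/-- A face of `K`: a convex subset that contains every segment of `K` whose relative interior it
meets. -/
def IsFace (K F : Set E) : Prop :=
  IsExtreme ℝ K F ∧ Convex ℝ F

/-- The intersection of all faces of `K` that contain `A`. -/
def minimalFace (K A : Set E) : Set E :=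
  ⋂₀ {F | IsFace K F ∧ A ⊆ F}

theorem isLeast_minimalFace {K A : Set E} (hK : Convex ℝ K) (hA : A ⊆ K) :
    IsLeast {F | IsFace K F ∧ A ⊆ F} (minimalFace K A) := by
  refine ⟨⟨⟨isExtreme_sInter ⟨K, ⟨IsExtreme.refl ℝ K, hK⟩, hA⟩ fun F hF => hF.1.1,
    convex_sInter fun F hF => hF.1.2⟩, subset_sInter fun F hF => hF.2⟩,
    fun F hF => sInter_subset_of_mem hF⟩

end ConvexGeometry

section Dynamics

/-- The set of `ω`-limit points of all trajectories of a semi-flow. -/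
def omegaLimitSet {X : Type*} [TopologicalSpace X] (φ : Flow ℝ≥0 X) : Set X :=
  ⋃ x, omegaLimit atTop φ {x}

/-- The equilibrium points of a semi-flow. -/
def equilibria {X : Type*} [TopologicalSpace X] (φ : Flow ℝ≥0 X) : Set X :=
  {x | ∀ t, φ t x = x}

variable {E : Type*} [NormedAddCommGroup E]

/-- `z : [0, ∞) → E` is a Carathéodory solution of `ż = g(z)`: it is absolutely continuous
(on every compact interval), and for almost all times its derivative exists and is `g (z t)`. -/
def IsCaratheodorySolution [NormedSpace ℝ E] (g : E → E) (z : ℝ≥0 → E) : Prop :=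
  (∀ T : ℝ, 0 < T → AbsolutelyContinuousOnInterval (fun t : ℝ => z t.toNNReal) 0 T) ∧
  ∀ᵐ t : ℝ, 0 < t → HasDerivAt (fun s : ℝ => z s.toNNReal) (g (z t.toNNReal)) t

end Dynamics

/-- The vector field `f(z) - P_{N_K(z)}(f(z))`. -/
def projectedField {E : Type*} [NormedAddCommGroup E] [InnerProductSpace ℝ E]
    (K : Set E) (f : E → E) (z : E) : E :=
  f z - projOnto (normalCone K z) (f z)

/-- The vector field `f(z) - P_{N_V}(f(z))` for an affine subspace `V`. -/
def affineProjectedField {E : Type*} [NormedAddCommGroup E] [InnerProductSpace ℝ E]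
    (V : AffineSubspace ℝ E) (f : E → E) (z : E) : E :=
  f z - projOnto (affineNormalCone V) (f z)

end

/-! ### Recurrence and isometry for nonexpansive semiflows -/

section NonexpansiveSemiflow

variable {X : Type*} [MetricSpace X] {φ : Flow ℝ≥0 X}

/-! Monotonicity of `-f` and of the normal cones makes `φ` nonexpansive (`lipschitzWith_flow`).
Points of `Ω` are then recurrent, any two of them simultaneously, so distances in `Ω` cannot shrink;
each `φ t` is an isometric bijection of `Ω`, and inverting gives the flow.

For `Ω ⊆ F`: strict convexity of the norm makes `φ` affine on segments of `Ω`, so the convex hull of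
`ω(z)`, for `z ∈ Ω`, is invariant, and its point `c` nearest an equilibrium is itself an
equilibrium. Some segment ending in `ω(z)` has `c` in its interior; flowing it until that end
returns near `z` puts `c` inside a segment of `K` from `z`, and faces through `c` contain `z`.

For the equation: on `Ω` the distance to each equilibrium is constant, so the normal part `v` of `f`
is orthogonal to the displacement to each equilibrium. The face of `K` on which `v` is maximal thus
contains `F`, whence `v ⟂ V`, while the velocity is parallel to `V`. The equation therefore has a
continuous right-hand side and holds at every time. -/

theorem mem_omegaLimit_singleton_iff_dist {x z : X} :
    z ∈ omegaLimit atTop φ {x} ↔ ∀ ε > 0, ∀ T : ℝ≥0, ∃ t ≥ T, dist (φ t x) z < ε := by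
  rw [mem_omegaLimit_singleton_iff_mapClusterPt,
    Metric.nhds_basis_ball.mapClusterPt_iff_frequently]
  simp only [frequently_atTop, Metric.mem_ball]

theorem mem_omegaLimitSet_iff {z : X} :
    z ∈ omegaLimitSet φ ↔
      ∃ x, ∀ ε > 0, ∀ T : ℝ≥0, ∃ t ≥ T, dist (φ t x) z < ε := by
  simp only [omegaLimitSet, mem_iUnion, mem_omegaLimit_singleton_iff_dist]

theorem mapsTo_omegaLimit_singleton (t : ℝ≥0) (x : X) :
    MapsTo (φ t) (omegaLimit atTop φ {x}) (omegaLimit atTop φ {x}) := by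
  intro z hz
  rw [mem_omegaLimit_singleton_iff_mapClusterPt] at hz ⊢
  have h := hz.continuousAt_comp (φ.continuous_toFun t).continuousAt
  refine MapClusterPt.of_comp (φ := fun s => t + s) (tendsto_atTop_mono (fun _ => le_add_self) tendsto_id) ?_
  simpa only [Function.comp_def, Flow.map_add] using h

theorem mapsTo_omegaLimitSet (t : ℝ≥0) : MapsTo (φ t) (omegaLimitSet φ) (omegaLimitSet φ) := by
  intro z hz
  obtain ⟨x, hx⟩ := mem_iUnion.1 hz
  exact mem_iUnion.2 ⟨x, mapsTo_omegaLimit_singleton t x hx⟩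

theorem equilibria_subset_omegaLimitSet : equilibria φ ⊆ omegaLimitSet φ := fun z hz =>
  mem_omegaLimitSet_iff.2 ⟨z, fun ε hε T => ⟨T, le_rfl, by rwa [hz T, dist_self]⟩⟩

theorem dist_flow_le (hφ : ∀ t, LipschitzWith 1 (φ t))
    (t : ℝ≥0) (x y : X) : dist (φ t x) (φ t y) ≤ dist x y := by
  simpa using (hφ t).dist_le_mul x y

theorem dist_flow_le_of_le (hφ : ∀ t, LipschitzWith 1 (φ t)) {s t : ℝ≥0} (h : s ≤ t) (x y : X) :
    dist (φ t x) (φ t y) ≤ dist (φ s x) (φ s y) := by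
  obtain ⟨r, rfl⟩ := exists_add_of_le h
  rw [add_comm, Flow.map_add, Flow.map_add]
  exact dist_flow_le hφ r _ _

/-- Every `ω`-limit point of a nonexpansive semiflow is recurrent. -/
theorem mem_omegaLimit_self (hφ : ∀ t, LipschitzWith 1 (φ t)) {z : X} (hz : z ∈ omegaLimitSet φ) :
    ∀ ε > 0, ∀ T : ℝ≥0, ∃ t ≥ T, dist (φ t z) z < ε := by
  obtain ⟨x, hx⟩ := mem_omegaLimitSet_iff.1 hz
  intro ε hε T
  -- The orbit of `x` is near `z` at time `s` and again at `s + T + u`; nonexpansiveness compares `φ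
  -- (T + u) z` with the second visit.
  obtain ⟨s, -, hs⟩ := hx (ε / 2) (half_pos hε) 0
  obtain ⟨r, hr, hr'⟩ := hx (ε / 2) (half_pos hε) (s + T)
  obtain ⟨u, rfl⟩ := exists_add_of_le hr
  refine ⟨T + u, le_self_add, ?_⟩
  have h := dist_flow_le hφ (T + u) z (φ s x)
  rw [← Flow.map_add, show T + u + s = s + T + u by abel, dist_comm z] at h
  linarith [dist_triangle (φ (T + u) z) (φ (s + T + u) x) z]

/-- When `φ t z` is close to `z`, so are `φ t (φ a z)` to `φ a z` and `φ t (φ b z)` to `φ b z`. Any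
distance lost by time `s` would have to be regained at some `t ≥ s`. -/
theorem dist_flow_flow_eq (hφ : ∀ t, LipschitzWith 1 (φ t))
    {z : X} (hz : z ∈ omegaLimitSet φ) (s a b : ℝ≥0) :
    dist (φ s (φ a z)) (φ s (φ b z)) = dist (φ a z) (φ b z) := by
  refine le_antisymm (dist_flow_le hφ _ _ _) (le_of_forall_pos_le_add fun ε hε => ?_)
  obtain ⟨t, ht, hd⟩ := mem_omegaLimit_self hφ hz (ε / 2) (half_pos hε) s
  have h1 := dist_flow_le hφ a (φ t z) z
  have h2 := dist_flow_le hφ b (φ t z) z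
  have h3 := dist_flow_le_of_le hφ ht (φ a z) (φ b z)
  simp only [← Flow.map_add, add_comm _ t] at h1 h2 h3 ⊢
  have h4 := dist_triangle4 (φ a z) (φ (t + a) z) (φ (t + b) z) (φ b z)
  rw [dist_comm (φ a z) (φ (t + a) z)] at h4
  simp only [add_comm s] at *
  linarith

theorem isBounded_range_flow (hφ : ∀ t, LipschitzWith 1 (φ t))
    (he : (equilibria φ).Nonempty) (z : X) :
    ∃ e R, ∀ t, φ t z ∈ Metric.closedBall e R := by
  obtain ⟨e, he⟩ := he
  refine ⟨e, dist z e, fun t => ?_⟩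
  rw [Metric.mem_closedBall]
  simpa only [he t] using dist_flow_le hφ t z e

/-- The orbit of a point in the `ω`-limit of a recurrent point `z` comes back close to `z`. -/
theorem exists_dist_flow_lt_of_mem_omegaLimit (hφ : ∀ t, LipschitzWith 1 (φ t))
    {z y : X} (hz : z ∈ omegaLimitSet φ)
    (hy : y ∈ omegaLimit atTop φ {z}) {ε : ℝ} (hε : 0 < ε) : ∃ t, dist (φ t y) z < ε := by
  obtain ⟨s, -, hs⟩ := mem_omegaLimit_singleton_iff_dist.1 hy (ε / 2) (half_pos hε) 0
  obtain ⟨r, hr, hr'⟩ := mem_omegaLimit_self hφ hz (ε / 2) (half_pos hε) s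
  obtain ⟨u, rfl⟩ := exists_add_of_le hr
  have h := dist_flow_le hφ u y (φ s z)
  rw [← Flow.map_add, add_comm u, dist_comm y] at h
  exact ⟨u, by linarith [dist_triangle (φ u y) (φ (s + u) z) z]⟩

variable [ProperSpace X]

/-- Two `ω`-limit points recur simultaneously. -/
theorem exists_dist_flow_lt_dist_flow_lt (hφ : ∀ t, LipschitzWith 1 (φ t))
    (he : (equilibria φ).Nonempty) {z w : X} (hz : z ∈ omegaLimitSet φ)
    (hw : w ∈ omegaLimitSet φ) {ε : ℝ} (hε : 0 < ε) (T : ℝ≥0) :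
    ∃ t ≥ T, dist (φ t z) z < ε ∧ dist (φ t w) w < ε := by
  obtain ⟨e, R, hR⟩ := isBounded_range_flow hφ he z
  obtain ⟨e', R', hR'⟩ := isBounded_range_flow hφ he w
  -- Compactness gives two multiples of `T` at which the pair of orbits is nearly the same; isometry
  -- along each orbit (`key`) cancels the earlier time, leaving `(1 + k) * T ≥ T`.
  obtain ⟨p, -, g, hg, hlim⟩ := ((isCompact_closedBall e R).prod
    (isCompact_closedBall e' R')).tendsto_subseq
    (x := fun n : ℕ => (φ (n * T) z, φ (n * T) w)) fun n => ⟨hR _, hR' _⟩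
  obtain ⟨N, hN⟩ := Metric.cauchySeq_iff'.1 hlim.cauchySeq ε hε
  have h := hN (N + 1) N.le_succ
  obtain ⟨k, hk⟩ := exists_add_of_le (Nat.succ_le_of_lt (hg N.lt_succ_self))
  simp only [Function.comp_apply, Prod.dist_eq, max_lt_iff, hk] at h
  refine ⟨(1 + k) * T, by rw [add_mul, one_mul]; exact le_self_add, ?_⟩
  have key : ∀ y ∈ omegaLimitSet φ,
      dist (φ (((g N).succ + k : ℕ) * T) y) (φ ((g N : ℕ) * T) y) = dist (φ ((1 + k) * T) y) y := by
    intro y hy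
    have := dist_flow_flow_eq hφ hy (g N * T) ((1 + k) * T) 0
    rw [Flow.map_zero_apply, ← Flow.map_add] at this
    rw [← this]
    congr 2
    push_cast
    ring
  rw [key z hz, key w hw] at h
  exact h

theorem dist_flow_eq (hφ : ∀ t, LipschitzWith 1 (φ t)) (he : (equilibria φ).Nonempty)
    {z w : X} (hz : z ∈ omegaLimitSet φ) (hw : w ∈ omegaLimitSet φ) (t : ℝ≥0) :
    dist (φ t z) (φ t w) = dist z w := by
  refine le_antisymm (dist_flow_le hφ _ _ _) (le_of_forall_pos_le_add fun ε hε => ?_)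
  obtain ⟨s, hs, h1, h2⟩ := exists_dist_flow_lt_dist_flow_lt hφ he hz hw (half_pos hε) t
  have h3 := dist_flow_le_of_le hφ hs z w
  have h4 := dist_triangle4 z (φ s z) (φ s w) w
  rw [dist_comm z (φ s z)] at h4
  linarith

/-- If `z` nearly returns at times `t + s n`, a limit point of `φ (s n) z` is a preimage. -/
theorem exists_mem_omegaLimitSet_flow_eq (hφ : ∀ t, LipschitzWith 1 (φ t))
    (he : (equilibria φ).Nonempty) {z : X} (hz : z ∈ omegaLimitSet φ) (t : ℝ≥0) :
    ∃ y ∈ omegaLimitSet φ, φ t y = z := by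
  obtain ⟨e, R, hR⟩ := isBounded_range_flow hφ he z
  have hrec : ∀ n : ℕ, ∃ s : ℝ≥0, (n : ℝ≥0) ≤ s ∧ dist (φ (t + s) z) z < 1 / ((n : ℝ) + 1) := by
    intro n
    obtain ⟨r, hr, hd⟩ := mem_omegaLimit_self hφ hz (1 / ((n : ℝ) + 1)) (by positivity) (t + n)
    obtain ⟨u, rfl⟩ := exists_add_of_le hr
    exact ⟨n + u, le_self_add, by rwa [← add_assoc]⟩
  choose s hs hd using hrec
  obtain ⟨y, -, g, hg, hlim⟩ := (isCompact_closedBall e R).tendsto_subseq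
    (x := fun n : ℕ => φ (s n) z) fun n => hR _
  have hst : Tendsto (fun n => s (g n)) atTop atTop :=
    (tendsto_atTop_mono hs tendsto_natCast_atTop_atTop).comp hg.tendsto_atTop
  refine ⟨y, mem_iUnion.2 ⟨z, (mem_omegaLimit_singleton_iff_mapClusterPt _ _ _ _).2
    (hlim.mapClusterPt.of_comp hst)⟩, ?_⟩
  have h1 : Tendsto (fun n => φ (t + s (g n)) z) atTop (𝓝 (φ t y)) := by
    simp only [Flow.map_add]
    exact ((φ.continuous_toFun t).tendsto y).comp hlim
  have h2 : Tendsto (fun n => φ (t + s n) z) atTop (𝓝 z) :=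
    tendsto_iff_dist_tendsto_zero.2 (squeeze_zero (fun _ => dist_nonneg) (fun n => (hd n).le)
      tendsto_one_div_add_atTop_nhds_zero_nat)
  exact tendsto_nhds_unique h1 (h2.comp hg.tendsto_atTop)

theorem flow_injOn_omegaLimitSet (hφ : ∀ t, LipschitzWith 1 (φ t)) (he : (equilibria φ).Nonempty)
    (t : ℝ≥0) : InjOn (φ t) (omegaLimitSet φ) := fun z hz w hw h => by
  rw [← dist_eq_zero, ← dist_flow_eq hφ he hz hw t, h, dist_self]

/-- A nonexpansive semiflow with an equilibrium extends, on its `ω`-limit set, to a flow of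
isometries. -/
theorem exists_flow_omegaLimitSet (hφ : ∀ t, LipschitzWith 1 (φ t)) (he : (equilibria φ).Nonempty) :
    ∃ ψ : Flow ℝ (omegaLimitSet φ),
      (∀ (t : ℝ≥0) (z : omegaLimitSet φ), (ψ (t : ℝ) z : X) = φ t z) ∧ ∀ t, Isometry (ψ t) := by
  -- One equation covers both signs of `t`, since one of the two truncated times is zero.
  have hex : ∀ (t : ℝ) (z : omegaLimitSet φ), ∃ w : omegaLimitSet φ,
      φ (-t).toNNReal w = φ t.toNNReal z := fun t z => by
    obtain ⟨w, hw, h⟩ := exists_mem_omegaLimitSet_flow_eq hφ he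
      (mapsTo_omegaLimitSet t.toNNReal z.2) (-t).toNNReal
    exact ⟨⟨w, hw⟩, h⟩
  choose ψ hψ using hex
  have hψ' : ∀ (t : ℝ) (z : omegaLimitSet φ) (a b : ℝ≥0), (b : ℝ) = a + t →
      φ a (ψ t z) = φ b z := by
    intro t z a b hab
    rcases le_total 0 t with ht | ht
    · have h := hψ t z
      rw [Real.toNNReal_of_nonpos (neg_nonpos.2 ht), Flow.map_zero_apply] at h
      rw [h, ← Flow.map_add]
      congr 1
      rw [← NNReal.coe_inj, hab, NNReal.coe_add, Real.coe_toNNReal _ ht]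
    · have h := hψ t z
      rw [Real.toNNReal_of_nonpos ht, Flow.map_zero_apply] at h
      rw [← h, ← Flow.map_add]
      congr 1
      rw [← NNReal.coe_inj, NNReal.coe_add, Real.coe_toNNReal _ (neg_nonneg.2 ht)]
      linarith
  have huniq : ∀ (t : ℝ) (z w : omegaLimitSet φ) (a b : ℝ≥0), (b : ℝ) = a + t →
      φ a w = φ b z → ψ t z = w := by
    intro t z w a b hab h
    exact Subtype.ext (flow_injOn_omegaLimitSet hφ he a (ψ t z).2 w.2 (by rw [hψ' t z a b hab, h]))
  have hshift : ∀ r : ℝ, ∃ m : ℝ≥0, -r ≤ m := fun r => ⟨(-r).toNNReal, Real.le_coe_toNNReal _⟩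
  have hisom : ∀ (m : ℝ≥0), Isometry fun z : omegaLimitSet φ => φ m z := fun m =>
    Isometry.of_dist_eq fun z w => dist_flow_eq hφ he z.2 w.2 m
  -- Continuity can be tested after the embedding `φ m`, with `m` so large that all times near `t`
  -- become positive.
  have hcont : Continuous (Function.uncurry ψ) := by
    rw [continuous_iff_continuousAt]
    rintro ⟨t, z⟩
    obtain ⟨m, hm⟩ := hshift (t - 1)
    rw [(hisom m).isEmbedding.continuousAt_iff]
    have hc : Continuous fun p : ℝ × omegaLimitSet φ => φ (m + p.1).toNNReal p.2 :=
      φ.continuous (by fun_prop) (by fun_prop)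
    refine hc.continuousAt.congr ?_
    have : ∀ᶠ p : ℝ × omegaLimitSet φ in 𝓝 (t, z), t - 1 < p.1 :=
      continuous_fst.continuousAt.eventually (lt_mem_nhds (by simp))
    filter_upwards [this] with p hp
    exact (hψ' p.1 p.2 m _ (Real.coe_toNNReal _ (by linarith))).symm
  refine ⟨⟨ψ, hcont, fun s t z => ?_, fun z => huniq 0 z z 0 0 (by simp) rfl⟩, fun t z => ?_,
    fun t => ?_⟩
  · obtain ⟨m, hm⟩ := hshift s
    obtain ⟨k, hk⟩ := hshift t
    refine huniq (s + t) z _ (m + k) (m + s + (k + t)).toNNReal ?_ ?_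
    · rw [Real.coe_toNNReal _ (by linarith), NNReal.coe_add]
      ring
    · have hms : 0 ≤ m + s := by linarith
      have hkt : 0 ≤ k + t := by linarith
      rw [add_comm m k, Flow.map_add, hψ' s (ψ t z) m (m + s).toNNReal (Real.coe_toNNReal _ hms),
        ← Flow.map_add, add_comm k, Flow.map_add,
        hψ' t z k (k + t).toNNReal (Real.coe_toNNReal _ hkt), ← Flow.map_add,
        Real.toNNReal_add hms hkt]
  · have := hψ' t z 0 t (by simp)
    rwa [Flow.map_zero_apply] at this
  · obtain ⟨m, hm⟩ := hshift t
    refine Isometry.of_dist_eq fun z w => ?_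
    have h := dist_flow_eq hφ he (ψ t z).2 (ψ t w).2 m
    have hmt := Real.coe_toNNReal (m + t) (by linarith)
    rw [hψ' t z m _ hmt, hψ' t w m _ hmt, dist_flow_eq hφ he z.2 w.2] at h
    exact h.symm

end NonexpansiveSemiflow

/-! ### Convex hulls in finite dimension -/

section ConvexHull

variable {E : Type*} [NormedAddCommGroup E] [NormedSpace ℝ E]

/-- In finite dimension, the convex hull of a compact set is compact. -/
theorem IsCompact.isCompact_convexHull [FiniteDimensional ℝ E] {s : Set E} (hs : IsCompact s) :
    IsCompact (convexHull ℝ s) := by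
  rcases s.eq_empty_or_nonempty with rfl | ⟨x₀, hx₀⟩
  · simp
  set d := Module.finrank ℝ E + 1
  -- By Carathéodory's theorem `d` points suffice; unused indices get weight `0` and the point `x₀`.
  have hcomp : IsCompact (stdSimplex ℝ (Fin d) ×ˢ univ.pi fun _ : Fin d => s) :=
    (isCompact_stdSimplex ℝ (Fin d)).prod (isCompact_univ_pi fun _ => hs)
  convert hcomp.image (f := fun p : (Fin d → ℝ) × (Fin d → E) => ∑ i, p.1 i • p.2 i)
    (by fun_prop)
  ext x
  constructor
  · intro hx
    obtain ⟨ι, _, z, w, hz, hind, hw, hw1, rfl⟩ := eq_pos_convex_span_of_mem_convexHull hx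
    obtain ⟨g⟩ : Nonempty (ι ↪ Fin d) :=
      Function.Embedding.nonempty_of_card_le (by
        rw [Fintype.card_fin]
        exact hind.card_le_finrank_succ.trans (Nat.succ_le_succ (Submodule.finrank_le _)))
    refine ⟨(Function.extend g w 0, Function.extend g z fun _ => x₀), ⟨⟨fun j => ?_, ?_⟩,
      fun j _ => ?_⟩, ?_⟩
    · by_cases hj : ∃ i, g i = j
      · obtain ⟨i, rfl⟩ := hj
        simpa [g.injective.extend_apply] using (hw i).le
      · simp [Function.extend_apply' _ _ _ hj]
    · rw [← hw1]
      refine (Fintype.sum_of_injective g g.injective _ _ (fun j hj => ?_) fun i => ?_).symm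
      · simp [Function.extend_apply' _ _ _ hj]
      · simp [g.injective.extend_apply]
    · by_cases hj : ∃ i, g i = j
      · obtain ⟨i, rfl⟩ := hj
        simpa [g.injective.extend_apply] using hz (mem_range_self i)
      · simpa [Function.extend_apply' _ _ _ hj] using hx₀
    · refine (Fintype.sum_of_injective g g.injective _ _ (fun j hj => ?_) fun i => ?_).symm
      · simp [Function.extend_apply' _ _ _ hj]
      · simp [g.injective.extend_apply]
  · rintro ⟨⟨w, z⟩, ⟨⟨hw, hw1⟩, hz⟩, rfl⟩
    exact (convex_convexHull ℝ s).sum_mem (fun i _ => hw i) hw1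
      fun i _ => subset_convexHull ℝ s (hz i (mem_univ i))

/-- A point of a convex hull can be pushed away from some generator without leaving the hull. -/
theorem exists_add_smul_sub_mem_convexHull {s : Set E} {c : E} (hc : c ∈ convexHull ℝ s) :
    ∃ y ∈ s, ∃ ε : ℝ, 0 < ε ∧ c + ε • (c - y) ∈ convexHull ℝ s := by
  obtain ⟨ι, _, z, w, hz, -, hw, hw1, hwc⟩ := eq_pos_convex_span_of_mem_convexHull hc
  classical
  obtain ⟨i₀⟩ : Nonempty ι := by
    by_contra h
    rw [not_nonempty_iff] at h
    simp at hw1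
  refine ⟨z i₀, hz (mem_range_self i₀), w i₀, hw i₀, ?_⟩
  -- With `ε = w i₀`, the new weight at `i₀` is `(w i₀) ^ 2`.
  have hmem := (convex_convexHull ℝ s).sum_mem (t := Finset.univ) (z := z)
    (w := fun i => (1 + w i₀) * w i - if i = i₀ then w i₀ else 0) (fun i _ => ?_) ?_
    fun i _ => subset_convexHull ℝ s (hz (mem_range_self i))
  · convert hmem
    simp only [sub_smul, Finset.sum_sub_distrib, mul_smul, ← Finset.smul_sum, hwc, ite_smul,
      zero_smul, Finset.sum_ite_eq', Finset.mem_univ, if_true]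
    module
  · have := hw i
    have := hw i₀
    split_ifs with h
    · subst h; nlinarith
    · nlinarith
  · simp [Finset.sum_sub_distrib, ← Finset.mul_sum, hw1]

end ConvexHull

/-! ### Faces and the ω-limit set -/

section NonexpansiveSemiflowOnConvexSet

variable {E : Type*} [NormedAddCommGroup E] [InnerProductSpace ℝ E] [FiniteDimensional ℝ E]
  {K : Set E} {φ : Flow ℝ≥0 K}

/-- A nonexpansive semiflow is affine along segments joining `ω`-limit points. -/
theorem flow_eq_lineMap (hφ : ∀ t, LipschitzWith 1 (φ t)) (hK : IsClosed K)
    (he : (equilibria φ).Nonempty) {z w m : K} (hz : z ∈ omegaLimitSet φ) (hw : w ∈ omegaLimitSet φ)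
    {r : ℝ} (hr : r ∈ Icc (0 : ℝ) 1) (hm : (m : E) = AffineMap.lineMap (z : E) (w : E) r)
    (t : ℝ≥0) : (φ t m : E) = AffineMap.lineMap (φ t z : E) (φ t w : E) r := by
  have := ProperSpace.of_isClosed hK
  have hd := dist_flow_eq hφ he hz hw t
  have h1 := dist_flow_le hφ t z m
  have h2 := dist_flow_le hφ t m w
  have h3 := dist_triangle (φ t z) (φ t m) (φ t w)
  have e1 : dist z m = r * dist z w := by
    rw [Subtype.dist_eq, Subtype.dist_eq, hm, dist_left_lineMap, Real.norm_of_nonneg hr.1]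
  have e2 : dist m w = (1 - r) * dist z w := by
    rw [Subtype.dist_eq, Subtype.dist_eq, hm, dist_lineMap_right,
      Real.norm_of_nonneg (sub_nonneg.2 hr.2)]
  -- The triangle inequality through `φ t m` forces equality in both nonexpansive bounds; strict
  -- convexity then determines the point.
  apply eq_lineMap_of_dist_eq_mul_of_dist_eq_mul
  · simp only [← Subtype.dist_eq, hd]; linarith
  · simp only [← Subtype.dist_eq, hd]; linarith

/-- Simultaneous recurrence of the endpoints and affinity of `φ t` make each point of the segment
recurrent. -/
theorem convex_omegaLimitSet (hφ : ∀ t, LipschitzWith 1 (φ t)) (hK : IsClosed K)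
    (he : (equilibria φ).Nonempty) (hKc : Convex ℝ K) :
    Convex ℝ (Subtype.val '' omegaLimitSet φ : Set E) := by
  have := ProperSpace.of_isClosed hK
  rw [convex_iff_segment_subset]
  rintro _ ⟨z, hz, rfl⟩ _ ⟨w, hw, rfl⟩ x hx
  have hxK : x ∈ K := hKc.segment_subset z.2 w.2 hx
  rw [segment_eq_image_lineMap] at hx
  obtain ⟨r, hr, hrx⟩ := hx
  refine ⟨⟨x, hxK⟩, mem_omegaLimitSet_iff.2 ⟨⟨x, hxK⟩, fun ε hε T => ?_⟩, rfl⟩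
  obtain ⟨t, ht, h1, h2⟩ := exists_dist_flow_lt_dist_flow_lt hφ he hz hw hε T
  refine ⟨t, ht, ?_⟩
  rw [Subtype.dist_eq, flow_eq_lineMap hφ hK he hz hw hr hrx.symm t]
  change dist _ x < ε
  rw [← hrx]
  rw [Subtype.dist_eq, dist_eq_norm] at h1 h2
  rw [dist_eq_norm, AffineMap.lineMap_apply_module, AffineMap.lineMap_apply_module,
    show (1 - r) • (φ t z : E) + r • (φ t w : E) - ((1 - r) • (z : E) + r • (w : E)) =
      (1 - r) • ((φ t z : E) - z) + r • ((φ t w : E) - w) by module]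
  exact mem_ball_zero_iff.1 (convex_ball (0 : E) ε (mem_ball_zero_iff.2 h1)
    (mem_ball_zero_iff.2 h2) (sub_nonneg.2 hr.2) hr.1 (by ring))

/-- The convex hull of the `ω`-limit of an `ω`-limit point contains an equilibrium. -/
theorem exists_mem_equilibria_mem_convexHull (hφ : ∀ t, LipschitzWith 1 (φ t)) (hK : IsClosed K)
    (he : (equilibria φ).Nonempty) (hKc : Convex ℝ K) {z : K}
    (hz : z ∈ omegaLimitSet φ) :
    ∃ c ∈ equilibria φ, (c : E) ∈ convexHull ℝ (Subtype.val '' omegaLimit atTop φ {z}) := by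
  have := ProperSpace.of_isClosed hK
  set O : Set E := Subtype.val '' omegaLimit atTop φ {z} with hO
  have hOΩ : O ⊆ Subtype.val '' omegaLimitSet φ :=
    image_mono (subset_iUnion (fun x => omegaLimit atTop φ {x}) z)
  have hconv := convex_omegaLimitSet hφ hK he hKc
  have hCΩ : convexHull ℝ O ⊆ Subtype.val '' omegaLimitSet φ := convexHull_min hOΩ hconv
  have hOc : IsCompact O := by
    obtain ⟨p, R, hR⟩ := isBounded_range_flow hφ he z
    refine IsCompact.image ((isCompact_closedBall p R).of_isClosed_subset
      (isClosed_omegaLimit _ _ _) ?_) continuous_subtype_val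
    refine (omegaLimit_subset_closure_image2 _ _ _ univ_mem).trans
      (closure_minimal ?_ Metric.isClosed_closedBall)
    rintro _ ⟨t, -, x, rfl, rfl⟩
    exact hR t
  have hinv : ∀ t, ∀ c : K, (c : E) ∈ convexHull ℝ O → (φ t c : E) ∈ convexHull ℝ O := by
    intro t c hc
    have hmin : convexHull ℝ O ⊆
        {x | ∃ y ∈ omegaLimitSet φ, (y : E) = x ∧ (φ t y : E) ∈ convexHull ℝ O} := by
      refine convexHull_min ?_ ?_
      · rintro _ ⟨y, hy, rfl⟩
        exact ⟨y, mem_iUnion.2 ⟨z, hy⟩, rfl,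
          subset_convexHull ℝ O ⟨_, mapsTo_omegaLimit_singleton t z hy, rfl⟩⟩
      · rw [convex_iff_segment_subset]
        rintro _ ⟨a, ha, rfl, ha'⟩ _ ⟨b, hb, rfl, hb'⟩ x hx
        obtain ⟨m, hm, rfl⟩ := hconv.segment_subset ⟨a, ha, rfl⟩ ⟨b, hb, rfl⟩ hx
        refine ⟨m, hm, rfl, ?_⟩
        rw [segment_eq_image_lineMap] at hx
        obtain ⟨r, hr, hrx⟩ := hx
        rw [flow_eq_lineMap hφ hK he ha hb hr hrx.symm t]
        exact (convex_convexHull ℝ O).segment_subset ha' hb'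
          (by rw [segment_eq_image_lineMap]; exact mem_image_of_mem _ hr)
    obtain ⟨y, -, hyc, hy⟩ := hmin hc
    rwa [Subtype.ext hyc] at hy
  obtain ⟨e, hee⟩ := he
  have hne : O.Nonempty :=
    ⟨z, z, mem_omegaLimit_singleton_iff_dist.2 (mem_omegaLimit_self hφ hz), rfl⟩
  have hcl := hOc.isCompact_convexHull.isClosed
  -- The flow keeps the nearest point to `e` in the hull without moving it farther from `e`, so
  -- uniqueness of the nearest point makes it fixed.
  obtain ⟨hc, hmin⟩ := projOnto_spec (hne.mono (subset_convexHull ℝ O)) hcl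
    (convex_convexHull ℝ O) (e : E)
  obtain ⟨c, hcΩ, hce⟩ := hCΩ hc
  rw [← hce] at hc hmin
  refine ⟨c, fun t => ?_, hc⟩
  refine Subtype.ext ((projOnto_unique hcl (convex_convexHull ℝ O) (hinv t c hc)
    fun q hq => ?_).symm.trans hce.symm)
  refine le_trans ?_ (hmin q hq)
  have := dist_flow_le hφ t e c
  rwa [hee t, Subtype.dist_eq, Subtype.dist_eq, dist_eq_norm, dist_eq_norm] at this

/-- Every face containing all equilibria contains the `ω`-limit set. -/
theorem omegaLimitSet_subset_of_isExtreme (hφ : ∀ t, LipschitzWith 1 (φ t)) (hK : IsClosed K)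
    (he : (equilibria φ).Nonempty) (hKc : Convex ℝ K) {F : Set E} (hF : IsExtreme ℝ K F)
    (heF : Subtype.val '' equilibria φ ⊆ F) : Subtype.val '' omegaLimitSet φ ⊆ F := by
  rintro _ ⟨z, hz, rfl⟩
  obtain ⟨c, hc, hcO⟩ := exists_mem_equilibria_mem_convexHull hφ hK he hKc hz
  obtain ⟨_, ⟨y, hy, rfl⟩, ε, hε, hp⟩ := exists_add_smul_sub_mem_convexHull hcO
  have hyΩ : y ∈ omegaLimitSet φ := mem_iUnion.2 ⟨z, hy⟩
  obtain ⟨p, hpΩ, hpe⟩ := convexHull_min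
    (image_mono (subset_iUnion (fun x => omegaLimit atTop φ {x}) z))
    (convex_omegaLimitSet hφ hK he hKc) hp
  have h1ε : (1 + ε) ≠ 0 := by positivity
  have hr : (1 + ε)⁻¹ ∈ Icc (0 : ℝ) 1 := ⟨by positivity, inv_le_one_of_one_le₀ (by linarith)⟩
  have hcp : (c : E) = AffineMap.lineMap (y : E) (p : E) (1 + ε)⁻¹ := by
    rw [hpe, AffineMap.lineMap_apply_module]
    match_scalars <;> field_simp
    ring
  -- This point is `φ t p`, because `c` is fixed and `φ t` is affine on the segment from `y` to `p`.
  have hmem : ∀ t, (c : E) + ε • ((c : E) - φ t y) ∈ K := by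
    intro t
    have h := flow_eq_lineMap hφ hK he hyΩ hpΩ hr hcp t
    rw [hc t, AffineMap.lineMap_apply_module] at h
    convert (φ t p).2
    rw [h]
    match_scalars <;> field_simp
    ring
  have hzK : (c : E) + ε • ((c : E) - z) ∈ K := by
    have hclosed : IsClosed {x : K | (c : E) + ε • ((c : E) - x) ∈ K} :=
      hK.preimage (f := fun x : K => (c : E) + ε • ((c : E) - x)) (by fun_prop)
    refine hclosed.closure_subset_iff.2 (range_subset_iff.2 hmem) ?_
    refine Metric.mem_closure_range_iff.2 fun δ hδ => ?_
    obtain ⟨t, ht⟩ := exists_dist_flow_lt_of_mem_omegaLimit hφ hz hy hδ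
    exact ⟨t, by rwa [dist_comm]⟩
  refine hF.left_mem_of_mem_openSegment z.2 hzK (heF ⟨c, hc, rfl⟩)
    ⟨ε / (1 + ε), (1 + ε)⁻¹, by positivity, by positivity, by field_simp; ring, ?_⟩
  match_scalars <;> field_simp
  ring

end NonexpansiveSemiflowOnConvexSet

/-! ### Absolutely continuous functions -/

section AbsolutelyContinuous

theorem LipschitzWith.comp_absolutelyContinuousOnInterval {X Y : Type*} [PseudoMetricSpace X]
    [PseudoMetricSpace Y] {C : ℝ≥0} {g : X → Y} (hg : LipschitzWith C g) {f : ℝ → X} {a b : ℝ}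
    (hf : AbsolutelyContinuousOnInterval f a b) :
    AbsolutelyContinuousOnInterval (fun t => g (f t)) a b := by
  refine squeeze_zero (fun t => Finset.sum_nonneg fun i _ => dist_nonneg) (fun t => ?_)
    (by simpa using! Tendsto.const_mul (C : ℝ) hf)
  rw [Finset.mul_sum]
  exact Finset.sum_le_sum fun i _ => hg.dist_le_mul _ _

/-- An absolutely continuous real function with almost everywhere nonpositive derivative does not
increase. -/
theorem AbsolutelyContinuousOnInterval.le_of_ae_hasDerivAt_nonpos {g g' : ℝ → ℝ} {a b : ℝ}
    (hab : a ≤ b) (hg : AbsolutelyContinuousOnInterval g a b)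
    (hd : ∀ᵐ t, t ∈ Ioc a b → HasDerivAt g (g' t) t ∧ g' t ≤ 0) : g b ≤ g a := by
  rw [← sub_nonpos, ← hg.integral_deriv_eq_sub, intervalIntegral.integral_of_le hab]
  refine setIntegral_nonpos_of_ae_restrict ?_
  rw [EventuallyLE, ae_restrict_iff' measurableSet_Ioc]
  filter_upwards [hd] with t ht htm
  rw [(ht htm).1.deriv]
  exact (ht htm).2

/-- An absolutely continuous function whose derivative is almost everywhere equal to a continuous
function is differentiable. -/
theorem hasDerivAt_of_ae_hasDerivAt_of_continuous {E : Type*} [NormedAddCommGroup E]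
    [NormedSpace ℝ E] [CompleteSpace E] {u h : ℝ → E} (hh : Continuous h)
    (hu : ∀ T : ℝ, 0 < T → AbsolutelyContinuousOnInterval u 0 T)
    (hd : ∀ᵐ t : ℝ, 0 < t → HasDerivAt u (h t) t) {t : ℝ} (ht : 0 < t) :
    HasDerivAt u (h t) t := by
  have hG : ∀ s, HasDerivAt (fun x => ∫ r in (0 : ℝ)..x, h r) (h s) s := fun s =>
    intervalIntegral.integral_hasDerivAt_right (hh.intervalIntegrable _ _)
      (hh.stronglyMeasurableAtFilter _ _) hh.continuousAt
  have hGc : ContDiff ℝ 1 fun x => ∫ r in (0 : ℝ)..x, h r := by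
    rw [contDiff_one_iff_deriv]
    refine ⟨fun s => (hG s).differentiableAt, ?_⟩
    rwa [show deriv (fun x => ∫ r in (0 : ℝ)..x, h r) = h from funext fun s => (hG s).deriv]
  have hT : (0 : ℝ) < t + 1 := by linarith
  -- The difference of `u` and the primitive of `h` has zero derivative almost everywhere, so it is
  -- constant; the endpoint `t + 1` keeps `t` interior.
  obtain ⟨C, hC⟩ := ((hu _ hT).sub
    hGc.contDiffOn.absolutelyContinuousOnInterval).const_of_ae_hasDerivAt_zero (by
      have h0 : ∀ᵐ s : ℝ, s ≠ 0 := by simp [ae_iff, measure_singleton]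
      filter_upwards [hd, h0] with s hs hs0 hsm
      rw [uIcc_of_le hT.le] at hsm
      simpa using (hs (lt_of_le_of_ne hsm.1 hs0.symm)).sub (hG s))
  refine ((hG t).add_const C).congr_of_eventuallyEq ?_
  filter_upwards [Ioo_mem_nhds ht (lt_add_one t)] with s hs
  have := hC s (by rw [uIcc_of_le hT.le]; exact ⟨hs.1.le, hs.2.le⟩)
  rw [Pi.sub_apply] at this
  rw [← this]
  abel

end AbsolutelyContinuous

/-! ### Normal cones and their projections -/

section NormalCone

variable {E : Type*} [NormedAddCommGroup E] [InnerProductSpace ℝ E]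

theorem isClosed_normalCone (K : Set E) (z : E) : IsClosed (normalCone K z) := by
  simp only [normalCone, ofPred_forall]
  exact isClosed_biInter fun w _ => isClosed_le (by fun_prop) continuous_const

theorem convex_normalCone (K : Set E) (z : E) : Convex ℝ (normalCone K z) := by
  intro u hu v hv a b ha hb _ w hw
  rw [inner_add_left, real_inner_smul_left, real_inner_smul_left]
  nlinarith [mul_nonneg ha (neg_nonneg.2 (hu w hw)), mul_nonneg hb (neg_nonneg.2 (hv w hw))]

theorem projOnto_normalCone_mem [CompleteSpace E] (K : Set E) (z x : E) :
    projOnto (normalCone K z) x ∈ normalCone K z :=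
  (projOnto_spec ⟨0, fun w _ => by simp⟩ (isClosed_normalCone K z) (convex_normalCone K z) x).1

theorem affineNormalCone_eq_orthogonal {V : AffineSubspace ℝ E} (hV : (V : Set E).Nonempty) :
    affineNormalCone V = (V.directionᗮ : Set E) := by
  obtain ⟨p, hp⟩ := hV
  ext v
  rw [← normalCone_coe_eq_affineNormalCone V hp, SetLike.mem_coe, Submodule.mem_orthogonal']
  refine ⟨fun h u hu => ?_, fun h w hw => (h _ (V.vsub_mem_direction hw hp)).le⟩
  have h1 := h _ (AffineSubspace.vadd_mem_of_mem_direction hu hp)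
  have h2 := h _ (AffineSubspace.vadd_mem_of_mem_direction (V.direction.neg_mem hu) hp)
  simp only [vadd_eq_add, add_sub_cancel_right, inner_neg_right] at h1 h2
  linarith

/-- By Pythagoras, the orthogonal part of `f z` is its nearest point in the orthogonal complement.
-/
theorem affineProjectedField_eq_of_sub_mem [CompleteSpace E] {V : AffineSubspace ℝ E}
    (hV : (V : Set E).Nonempty) (f : E → E) {z v : E} (hv : v ∈ V.directionᗮ)
    (hfv : f z - v ∈ V.direction) : affineProjectedField V f z = f z - v := by
  rw [affineProjectedField, affineNormalCone_eq_orthogonal hV, projOnto_unique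
    V.direction.isClosed_orthogonal V.directionᗮ.convex hv fun q hq => ?_]
  have h : ⟪f z - v, v - q⟫ = 0 :=
    Submodule.inner_right_of_mem_orthogonal hfv (V.directionᗮ.sub_mem hv hq)
  have := norm_add_sq_eq_norm_sq_add_norm_sq_of_inner_eq_zero _ _ h
  rw [sub_add_sub_cancel] at this
  nlinarith [norm_nonneg (f z - v), norm_nonneg (f z - q), mul_self_nonneg ‖v - q‖]

theorem affineProjectedField_eq_starProjection [FiniteDimensional ℝ E] {V : AffineSubspace ℝ E}
    (hV : (V : Set E).Nonempty) (f : E → E) (z : E) :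
    affineProjectedField V f z = V.direction.starProjection (f z) := by
  have := FiniteDimensional.complete ℝ E
  rw [affineProjectedField_eq_of_sub_mem hV f
    (V.direction.sub_starProjection_mem_orthogonal (f z)) (by simp), sub_sub_cancel]

/-- The points of `K` at which a normal vector at `z ∈ K` attains its maximum form a face. -/
theorem isFace_of_mem_normalCone {K : Set E} (hK : Convex ℝ K) {z v : E}
    (hv : v ∈ normalCone K z) : IsFace K {w ∈ K | ⟪v, w - z⟫ = 0} := by
  refine ⟨⟨fun w hw => hw.1, ?_⟩, ?_⟩
  · rintro x hx y hy _ ⟨-, hw⟩ ⟨a, b, ha, hb, hab, rfl⟩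
    refine ⟨hx, le_antisymm (hv x hx) ?_⟩
    have e : a • x + b • y - z = a • (x - z) + b • (y - z) := by
      obtain rfl : b = 1 - a := by linarith
      module
    rw [e, inner_add_right, real_inner_smul_right, real_inner_smul_right] at hw
    nlinarith [hv y hy, hv x hx]
  · rintro x ⟨hx, hx0⟩ y ⟨hy, hy0⟩ a b ha hb hab
    refine ⟨hK hx hy ha hb hab, ?_⟩
    have e : a • x + b • y - z = a • (x - z) + b • (y - z) := by
      obtain rfl : b = 1 - a := by linarith
      module
    rw [e, inner_add_right, real_inner_smul_right, real_inner_smul_right, hx0, hy0]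
    simp

end NormalCone

/-! ### Nonexpansiveness of the projected dynamics -/

section ProjectedDynamics

variable {E : Type*} [NormedAddCommGroup E] [InnerProductSpace ℝ E]
  {K : Set E} {f : E → E} {φ : Flow ℝ≥0 K}

/-- The terms from `f` and from the normal cone at `w` are nonpositive and dropped. The term at `z`
is kept because its equality case is needed at equilibria. -/
theorem inner_projectedField_sub_le [CompleteSpace E]
    (hf_mono : ∀ z ∈ K, ∀ w ∈ K, ⟪f z - f w, z - w⟫ ≤ 0)
    {z w : E} (hz : z ∈ K) (hw : w ∈ K) :
    ⟪z - w, projectedField K f z - projectedField K f w⟫ ≤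
      ⟪projOnto (normalCone K z) (f z), w - z⟫ := by
  have h1 := projOnto_normalCone_mem K w (f w) z hz
  have h2 := hf_mono z hz w hw
  rw [projectedField, projectedField]
  set u := projOnto (normalCone K z) (f z)
  set v := projOnto (normalCone K w) (f w)
  rw [show f z - u - (f w - v) = (f z - f w) - u + v by abel, inner_add_right, inner_sub_right,
    real_inner_comm, real_inner_comm u, real_inner_comm v, ← neg_sub z w, inner_neg_right]
  linarith

theorem lipschitzWith_flow [CompleteSpace E]
    (hφ : ∀ z : K, IsCaratheodorySolution (projectedField K f) fun t => (φ t z : E))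
    (hf_mono : ∀ z ∈ K, ∀ w ∈ K, ⟪f z - f w, z - w⟫ ≤ 0) (t : ℝ≥0) :
    LipschitzWith 1 (φ t) := by
  refine LipschitzWith.of_dist_le_mul fun z w => ?_
  rw [NNReal.coe_one, one_mul]
  rcases eq_or_ne t 0 with rfl | ht
  · simp
  have ht : (0 : ℝ) < t := NNReal.coe_pos.2 (pos_iff_ne_zero.2 ht)
  have hac := ((hφ z).1 t ht).sub ((hφ w).1 t ht)
  have hn := lipschitzWith_one_norm.comp_absolutelyContinuousOnInterval hac
  have hle := (hn.fun_mul hn).le_of_ae_hasDerivAt_nonpos ht.le (g' := fun s =>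
      2 * ⟪(φ s.toNNReal z : E) - φ s.toNNReal w, projectedField K f (φ s.toNNReal z) -
        projectedField K f (φ s.toNNReal w)⟫) (by
    filter_upwards [(hφ z).2, (hφ w).2] with s hsz hsw hs
    refine ⟨?_, ?_⟩
    · simpa only [← sq, Pi.sub_apply] using! ((hsz hs.1).sub (hsw hs.1)).norm_sq
    · have h1 := inner_projectedField_sub_le hf_mono (φ s.toNNReal z).2 (φ s.toNNReal w).2
      have h2 := projOnto_normalCone_mem K (φ s.toNNReal z) (f (φ s.toNNReal z))
        (φ s.toNNReal w) (φ s.toNNReal w).2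
      linarith)
  simp only [Pi.sub_apply, Real.toNNReal_coe, Real.toNNReal_zero, Flow.map_zero_apply] at hle
  rw [Subtype.dist_eq, Subtype.dist_eq, dist_eq_norm, dist_eq_norm]
  exact abs_le_of_sq_le_sq' (by simpa only [sq] using hle) (norm_nonneg _) |>.2

/-- The equation holds almost everywhere, hence at some positive time of the constant trajectory. -/
theorem projectedField_eq_zero_of_mem_equilibria
    (hφ : ∀ z : K, IsCaratheodorySolution (projectedField K f) fun t => (φ t z : E))
    {e : K} (he : e ∈ equilibria φ) :
    projectedField K f e = 0 := by
  have h := (hφ e).2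
  simp only [he _] at h
  have hpos : (volume : Measure ℝ) (Ioi 0) ≠ 0 := by simp
  obtain ⟨t, ht, hd⟩ := ((frequently_ae_mem_iff.2 hpos).and_eventually h).exists
  exact (hd ht).unique (hasDerivAt_const t _)

end ProjectedDynamics

/-! ### The equation on the ω-limit set -/

section OmegaLimitDynamics

variable {E : Type*} [NormedAddCommGroup E] [InnerProductSpace ℝ E]

theorem mem_orthogonal_direction_affineSpan {F : Set E} {v x : E}
    (h : ∀ w ∈ F, ⟪v, w - x⟫ = 0) : v ∈ (affineSpan ℝ F).directionᗮ := by
  rw [direction_affineSpan, vectorSpan_def, Submodule.mem_orthogonal']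
  intro u hu
  induction hu using Submodule.span_induction with
  | mem u hu =>
    obtain ⟨a, ha, b, hb, rfl⟩ := hu
    change ⟪v, a - b⟫ = 0
    rw [← sub_sub_sub_cancel_right a b x, inner_sub_right, h a ha, h b hb, sub_zero]
  | zero => simp
  | add a b _ _ ha hb => rw [inner_add_right, ha, hb, add_zero]
  | smul r a _ ha => rw [real_inner_smul_right, ha, mul_zero]

theorem HasDerivAt.mem_direction [FiniteDimensional ℝ E] {V : AffineSubspace ℝ E} {u : ℝ → E}
    {u' : E} {t : ℝ} (hd : HasDerivAt u u' t) (hu : ∀ s, u s ∈ V) : u' ∈ V.direction := by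
  rw [← V.direction.orthogonal_orthogonal, Submodule.mem_orthogonal]
  intro q hq
  have h1 := (hasDerivAt_const t q).inner ℝ (hd.sub_const (u t))
  have h2 : (fun s => ⟪q, u s - u t⟫) = fun _ => 0 := funext fun s =>
    Submodule.inner_left_of_mem_orthogonal (V.vsub_mem_direction (hu s) (hu t)) hq
  rw [h2] at h1
  simpa using h1.unique (hasDerivAt_const t 0)

variable [FiniteDimensional ℝ E] {K : Set E} {f : E → E} {φ : Flow ℝ≥0 K}

/-- At an `ω`-limit point, the normal component of the field is orthogonal to the displacement from
every equilibrium. -/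
theorem inner_projOnto_normalCone_equilibrium_eq_zero (hK : IsClosed K)
    (hf_mono : ∀ z ∈ K, ∀ w ∈ K, ⟪f z - f w, z - w⟫ ≤ 0)
    (hφ : ∀ z : K, IsCaratheodorySolution (projectedField K f) fun t => (φ t z : E))
    {z e : K} (hz : z ∈ omegaLimitSet φ) (he : e ∈ equilibria φ) {t : ℝ}
    (hd : HasDerivAt (fun s : ℝ => (φ s.toNNReal z : E))
      (projectedField K f (φ t.toNNReal z)) t) :
    ⟪projOnto (normalCone K (φ t.toNNReal z)) (f (φ t.toNNReal z)),
      (e : E) - φ t.toNNReal z⟫ = 0 := by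
  have := ProperSpace.of_isClosed hK
  have hlip := lipschitzWith_flow hφ hf_mono
  set x := φ t.toNNReal z
  -- Equilibria lie in `Ω`, so the distance to `e` is constant along the trajectory.
  have h1 : ⟪(x : E) - e, projectedField K f x⟫ = 0 := by
    have h2 := (hd.sub_const (e : E)).norm_sq
    have h3 : (fun s : ℝ => ‖(φ s.toNNReal z : E) - e‖ ^ 2) = fun _ => ‖(z : E) - e‖ ^ 2 := by
      funext s
      have := dist_flow_eq hlip ⟨e, he⟩ hz (equilibria_subset_omegaLimitSet he) s.toNNReal
      rw [he, Subtype.dist_eq, Subtype.dist_eq, dist_eq_norm, dist_eq_norm] at this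
      rw [this]
    rw [h3] at h2
    simpa using h2.unique (hasDerivAt_const t _)
  have h2 := inner_projectedField_sub_le hf_mono x.2 e.2
  rw [projectedField_eq_zero_of_mem_equilibria hφ he, sub_zero, h1] at h2
  exact le_antisymm (projOnto_normalCone_mem K x (f x) e e.2) h2

/-- Trajectories of `ω`-limit points solve the equation projected onto the affine span of the
minimal face containing the equilibria. -/
theorem hasDerivAt_flow_of_mem_omegaLimitSet (hK : IsClosed K) (hKc : Convex ℝ K)
    (hf : ContinuousOn f K)
    (hf_mono : ∀ z ∈ K, ∀ w ∈ K, ⟪f z - f w, z - w⟫ ≤ 0)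
    (hφ : ∀ z : K, IsCaratheodorySolution (projectedField K f) fun t => (φ t z : E))
    (he : (equilibria φ).Nonempty) {z : K} (hz : z ∈ omegaLimitSet φ) {t : ℝ} (ht : 0 < t) :
    HasDerivAt (fun s : ℝ => (φ s.toNNReal z : E))
      (affineProjectedField (affineSpan ℝ (minimalFace K (Subtype.val '' equilibria φ))) f
        (φ t.toNNReal z)) t := by
  set F := minimalFace K (Subtype.val '' equilibria φ)
  have hlip := lipschitzWith_flow hφ hf_mono
  obtain ⟨⟨hF, heF⟩, hFmin⟩ := isLeast_minimalFace hKc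
    (show Subtype.val '' equilibria φ ⊆ K from image_subset_iff.2 fun x _ => x.2)
  have hΩF := omegaLimitSet_subset_of_isExtreme hlip hK he hKc hF.1 heF
  have hV : (affineSpan ℝ F : Set E).Nonempty :=
    (affineSpan_nonempty ℝ).2 ((he.image _).mono heF)
  have hmem : ∀ s : ℝ, (φ s.toNNReal z : E) ∈ affineSpan ℝ F := fun s =>
    subset_affineSpan ℝ F (hΩF ⟨_, mapsTo_omegaLimitSet _ hz, rfl⟩)
  refine hasDerivAt_of_ae_hasDerivAt_of_continuous
    (h := fun t => affineProjectedField (affineSpan ℝ F) f (φ t.toNNReal z)) ?_ (hφ z).1 ?_ ht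
  · simp only [affineProjectedField_eq_starProjection hV]
    exact (affineSpan ℝ F).direction.starProjection.continuous.comp
      (hf.comp_continuous (continuous_subtype_val.comp
        (φ.continuous continuous_real_toNNReal continuous_const)) fun s => (φ s.toNNReal z).2)
  · filter_upwards [(hφ z).2] with s hs hs0
    have hd := hs hs0
    have hface := isFace_of_mem_normalCone hKc
      (projOnto_normalCone_mem K (φ s.toNNReal z) (f (φ s.toNNReal z)))
    -- Minimality puts `F` inside the face where the normal component is maximal, so that component
    -- is orthogonal to the span of `F`.
    have hsub := hFmin ⟨hface, ?_⟩
    · have hv := mem_orthogonal_direction_affineSpan fun w hw => (hsub hw).2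
      rwa [affineProjectedField_eq_of_sub_mem hV f hv (hd.mem_direction hmem)]
    · rintro _ ⟨e, hee, rfl⟩
      exact ⟨e.2, inner_projOnto_normalCone_equilibrium_eq_zero hK hf_mono hφ hz hee hd⟩

end OmegaLimitDynamics

theorem mainTheorem1 (n : ℕ) (K : Set (EuclideanSpace ℝ (Fin n)))
    (hK_ne : K.Nonempty) (hK_closed : IsClosed K) (hK_convex : Convex ℝ K)
    (f : EuclideanSpace ℝ (Fin n) → EuclideanSpace ℝ (Fin n))
    (hf : ContDiffOn ℝ 1 f K)
    (hf_mono : ∀ z ∈ K, ∀ w ∈ K, inner ℝ (f z - f w) (z - w) ≤ 0)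
    (φ : Flow ℝ≥0 K)
    (hφ : ∀ z : K, IsCaratheodorySolution (projectedField K f)
      (fun t => (φ t z : EuclideanSpace ℝ (Fin n))))
    (h_eq : (equilibria φ).Nonempty) :
    Subtype.val '' omegaLimitSet φ ⊆ minimalFace K (Subtype.val '' equilibria φ) ∧
    ContDiffOn ℝ 1
      (affineProjectedField (affineSpan ℝ (minimalFace K (Subtype.val '' equilibria φ))) f) K ∧
    ∃ ψ : Flow ℝ (omegaLimitSet φ),
      (∀ (t : ℝ≥0) (z : omegaLimitSet φ), (ψ (t : ℝ) z : K) = φ t z) ∧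
      (∀ t : ℝ, Isometry (ψ t)) ∧
      ∀ (z : omegaLimitSet φ) (t : ℝ),
        HasDerivAt (fun s : ℝ => ((ψ s z : K) : EuclideanSpace ℝ (Fin n)))
          (affineProjectedField (affineSpan ℝ (minimalFace K (Subtype.val '' equilibria φ))) f
            ((ψ t z : K) : EuclideanSpace ℝ (Fin n))) t := by
  have := ProperSpace.of_isClosed hK_closed
  have hlip := lipschitzWith_flow hφ hf_mono
  obtain ⟨⟨hF, heF⟩, -⟩ := isLeast_minimalFace hK_convex
    (show Subtype.val '' equilibria φ ⊆ K from image_subset_iff.2 fun x _ => x.2)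
  refine ⟨omegaLimitSet_subset_of_isExtreme hlip hK_closed h_eq hK_convex hF.1 heF, ?_, ?_⟩
  · have hV := (affineSpan_nonempty ℝ).2 ((h_eq.image _).mono heF)
    rw [funext (affineProjectedField_eq_starProjection hV f)]
    exact (ContinuousLinearMap.contDiff _).comp_contDiffOn hf
  · obtain ⟨ψ, hψ, hiso⟩ := exists_flow_omegaLimitSet hlip h_eq
    refine ⟨ψ, hψ, hiso, fun z t => ?_⟩
    -- Restarting from `ψ (-m) z` makes the time `t + m` positive, where the forward equation
    -- applies.
    set m : ℝ := |t| + 1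
    have hmt : 0 < t + m := by linarith [neg_abs_le t]
    have hflow : ∀ s, 0 ≤ s + m → (ψ s z : K) = φ (s + m).toNNReal (ψ (-m) z) := by
      intro s hs
      rw [← hψ, Real.coe_toNNReal _ hs, ← Flow.map_add, add_neg_cancel_right]
    have hd := (hasDerivAt_flow_of_mem_omegaLimitSet hK_closed hK_convex hf.continuousOn hf_mono
      hφ h_eq (ψ (-m) z).2 hmt).comp_add_const t m
    rw [hflow t hmt.le]
    refine hd.congr_of_eventuallyEq ?_
    filter_upwards [lt_mem_nhds (show -m < t by linarith)] with s hs
    rw [hflow s (by linarith)]
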